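/- **Definitions.** Let $(S,+)$ be a commutative semigroup, $B\subseteq S$, and $-t+B=\{y\in S: t+y\in B\}$. - $B$ is *syndetic* if there is a finite nonempty $G\subseteq S$ with $S=\bigcup_{t\in G}(-t+B)$. - $B$ is *piecewise syndetic* (PS) if there is a finite nonempty $G\subseteq S$ such that for every finite nonempty $F\subseteq S$ there is $x\in S$ with $F+x\subseteq\bigcup_{t\in G}(-t+B)$. - $B$ is an *IP set* if there is a sequence $(x_n)_{n\ge1}$ in $S$ such that $\sum_{n\in F}x_n\in B$ for every finite nonempty $F\subseteq\mathbb N$. - $B$ is a *$\Delta$ set* if there is a sequence $(x_n)_{n\ge1}$ in $S$ with $x_m\in x_n+B$ for all $n<m$. - $B$ is *central* if it is a member of some minimal idempotent of $\beta S$, the semigroup of ultrafilters on $S$ with $B\in p+q\iff\{x:-x+B\in q\}\in p$. - For each such property $\mathcal E$, $B$ is an *$\mathcal E^*$ set* if $B$ meets every subset of $S$ with property $\mathcal E$; syndetic$^*$ sets are called *thick*. **Theorem.** Let $A$ be a $u\times v$ matrix with entries from $\mathbb Q[i]$, let $$I=\{A\vec z:\vec z\in\mathbb Z[i]^v\}\cap\mathbb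 Z[i]^u$$ (an additive subgroup of $\mathbb Z[i]^u$, in particular nonempty), and let $C\subseteq\mathbb Z[i]$. (a) If "large" is IP$^*$ or $\Delta^*$, and $C$ is large in $\mathbb Z[i]$, then $I\cap C^u$ is large in $I$ (in the same sense). If no row of $A$ is zero, the same holds when "large" is PS$^*$ or central$^*$. (b) If $\vec 1=(1,\dots,1)\in I$, "large" is any of piecewise syndetic, central, or thick, and $C$ is large in $\mathbb Z[i]$, then $I\cap C^u$ is large in $I$ (in the same sense). -/

import Mathlib

/-! Notions of largeness in a commutative semigroup. The semigroups of interest here, `ℤ[i]` and its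
image groups, have a zero, so the definitions are made for additive commutative monoids. -/

section Largeness

variable {S : Type*} [AddCommMonoid S]

/-- `B` is syndetic: `S = ⋃ t ∈ G, (-t + B)` for a finite nonempty `G`, where
`-t + B = {y | t + y ∈ B}`. -/
def IsSyndetic (B : Set S) : Prop :=
  ∃ G : Finset S, G.Nonempty ∧ ∀ y : S, ∃ t ∈ G, t + y ∈ B

/-- `B` is piecewise syndetic: there is a finite nonempty `G` such that every finite nonempty `F`
has a translate `F + x` contained in `⋃ t ∈ G, (-t + B)`. -/
def IsPiecewiseSyndetic (B : Set S) : Prop :=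
  ∃ G : Finset S, G.Nonempty ∧ ∀ F : Finset S, F.Nonempty →
    ∃ x : S, ∀ y ∈ F, ∃ t ∈ G, t + (y + x) ∈ B

/-- `B` is an IP set: it contains all sums over finite nonempty sets of indices of some
sequence. -/
def IsIP (B : Set S) : Prop :=
  ∃ x : ℕ → S, ∀ F : Finset ℕ, F.Nonempty → ∑ n ∈ F, x n ∈ B

/-- `B` is a Δ set: there is a sequence with `x m ∈ x n + B` whenever `n < m`. -/
def IsDelta (B : Set S) : Prop :=
  ∃ x : ℕ → S, ∀ n m : ℕ, n < m → ∃ b ∈ B, x m = x n + b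

section

attribute [local instance] Ultrafilter.add

/-- A minimal idempotent of `βS`, the semigroup of ultrafilters on `S` in which
`B ∈ p + q ↔ {x | -x + B ∈ q} ∈ p`: an idempotent that is minimal for the order
`q ≤ p ↔ q = p + q ∧ q = q + p` on idempotents (equivalently, an idempotent in the smallest ideal
of `βS`). -/
def IsMinimalIdempotent (p : Ultrafilter S) : Prop :=
  p + p = p ∧ ∀ q : Ultrafilter S, q + q = q → q = p + q → q = q + p → q = p

end

/-- `B` is central: it belongs to some minimal idempotent of `βS`. -/
def IsCentral (B : Set S) : Prop :=
  ∃ p : Ultrafilter S, IsMinimalIdempotent p ∧ B ∈ p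

end Largeness

/-- The dual of a property `E` of subsets: `B` is an `E*` set if it meets every `E` set. -/
def IsDual {S : Type*} (E : Set S → Prop) (B : Set S) : Prop :=
  ∀ D : Set S, E D → (B ∩ D).Nonempty

section

variable {S : Type*} [AddCommMonoid S]

/-- `IP*` sets. -/
def IsIPStar (B : Set S) : Prop := IsDual IsIP B

/-- `Δ*` sets. -/
def IsDeltaStar (B : Set S) : Prop := IsDual IsDelta B

/-- `PS*` sets. -/
def IsPSStar (B : Set S) : Prop := IsDual IsPiecewiseSyndetic B

/-- `central*` sets. -/
def IsCentralStar (B : Set S) : Prop := IsDual IsCentral B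

/-- Thick sets, that is, `syndetic*` sets. -/
def IsThick (B : Set S) : Prop := IsDual IsSyndetic B

end

/-- The set `I = {A z : z ∈ ℤ[i]^v} ∩ ℤ[i]^u`, as a subgroup of `ℤ[i]^u`. -/
noncomputable def imageGroup {u v : ℕ} (A : Matrix (Fin u) (Fin v) ℂ) :
    AddSubgroup (Fin u → GaussianInt) where
  carrier := {y | ∃ z : Fin v → GaussianInt,
    A.mulVec (fun j => GaussianInt.toComplex (z j)) = fun i => GaussianInt.toComplex (y i)}
  zero_mem' := ⟨0, by
    ext i
    simp [Matrix.mulVec, dotProduct]⟩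
  add_mem' := by
    rintro y y' ⟨z, hz⟩ ⟨z', hz'⟩
    refine ⟨z + z', ?_⟩
    ext i
    have h := congrFun hz i
    have h' := congrFun hz' i
    simp only [Matrix.mulVec, dotProduct] at h h'
    simp [Matrix.mulVec, dotProduct, mul_add, Finset.sum_add_distrib, h, h']
  neg_mem' := by
    rintro y ⟨z, hz⟩
    refine ⟨-z, ?_⟩
    ext i
    have h := congrFun hz i
    simp only [Matrix.mulVec, dotProduct] at h
    simp [Matrix.mulVec, dotProduct, h]

/-- The set `I ∩ C^u`, as a subset of the group `I`. -/
def imagesIn {u v : ℕ} (A : Matrix (Fin u) (Fin v) ℂ) (C : Set GaussianInt) :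
    Set (imageGroup A) :=
  {y | ∀ i, (y : Fin u → GaussianInt) i ∈ C}

/-! ### Minimal left ideals and idempotents. -/

section RightTopologicalSemigroup

variable {M : Type*} [AddSemigroup M] [TopologicalSpace M] [CompactSpace M] [T2Space M]

/-! `I ∩ C^u` is the finite intersection of the preimages of `C` under the coordinate homomorphisms
`I → ℤ[i]`, so the theorem is about pulling largeness back along finitely many homomorphisms. For
(a), an IP* or central* set belongs to every idempotent, resp. every minimal idempotent, of `βS`.
Homomorphisms push idempotents forward, and finite intersections stay in an ultrafilter. Minimality
survives the push when the range lies in every idempotent (`IsMinimalIdempotent.map`); a nonzero row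
ensures this, since the range then contains all multiples of a nonzero integer. PS* reduces to
minimal idempotents by translation; Δ* uses iterated ultrafilter limits of differences. For (b), `w
↦ w • (1, …, 1)` is a common section of all coordinates and carries largeness from `ℤ[i]` into `I`.
-/

/-- In a compact right topological semigroup, every principal left ideal `M + q` contains a
nonempty closed set `N` which is a left ideal generated by any of its elements. -/
theorem exists_minimal_closed_leftIdeal (hc : ∀ r : M, Continuous (· + r)) (q : M) :
    ∃ N : Set M, IsClosed N ∧ N.Nonempty ∧ N ⊆ Set.range (· + q) ∧
      ∀ x ∈ N, Set.range (· + x) = N := by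
  let 𝒩 : Set (Set M) := {N | IsClosed N ∧ N.Nonempty ∧ ∀ r, ∀ x ∈ N, r + x ∈ N}
  have hrange : ∀ x : M, Set.range (· + x) ∈ 𝒩 := fun x =>
    ⟨(isCompact_range (hc x)).isClosed, ⟨_, x, rfl⟩, by
      rintro r _ ⟨s, rfl⟩
      exact ⟨r + s, add_assoc _ _ _⟩⟩
  obtain ⟨N, hNq, hN⟩ : ∃ N, N ⊆ Set.range (· + q) ∧ Minimal (· ∈ 𝒩) N := by
    refine zorn_superset_nonempty 𝒩 ?_ _ (hrange q)
    intro c hc𝒩 hchain hne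
    refine ⟨⋂₀ c, ⟨isClosed_sInter fun t ht => (hc𝒩 ht).1, ?_, ?_⟩,
      fun s hs => Set.sInter_subset_of_mem hs⟩
    · rw [Set.sInter_eq_iInter]
      have := hne.coe_sort
      refine IsCompact.nonempty_iInter_of_directed_nonempty_isCompact_isClosed _
        (DirectedOn.directed_val (IsChain.directedOn hchain.symm)) (fun i => (hc𝒩 i.2).2.1)
        (fun i => (hc𝒩 i.2).1.isCompact) (fun i => (hc𝒩 i.2).1)
    · intro r x hx t ht
      exact (hc𝒩 ht).2.2 r x (hx t ht)
  refine ⟨N, hN.prop.1, hN.prop.2.1, hNq, fun x hx => ?_⟩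
  refine hN.eq_of_subset (hrange x) ?_
  rintro _ ⟨r, rfl⟩
  exact hN.prop.2.2 r x hx

/-- Every principal left ideal of a compact right topological semigroup contains an idempotent
that generates a minimal left ideal. -/
theorem exists_idempotent_leftMinimal_mem_range (hc : ∀ r : M, Continuous (· + r)) (q : M) :
    ∃ e ∈ Set.range (· + q), e + e = e ∧ ∀ r, ∃ s, s + (r + e) = e := by
  obtain ⟨N, hcl, hne, hNq, hN⟩ := exists_minimal_closed_leftIdeal hc q
  have hideal : ∀ r, ∀ x ∈ N, r + x ∈ N := fun r x hx => by
    rw [← hN x hx]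
    exact ⟨r, rfl⟩
  obtain ⟨e, he, hee⟩ := exists_idempotent_in_compact_add_subsemigroup hc N hne hcl.isCompact
    fun x _ y hy => hideal x y hy
  refine ⟨e, hNq he, hee, fun r => ?_⟩
  have : e ∈ Set.range (· + (r + e)) := by rwa [hN _ (hideal r e he)]
  exact this

/-- Below every idempotent of a compact right topological semigroup there is an idempotent
generating a minimal left ideal. -/
theorem exists_idempotent_leftMinimal_le (hc : ∀ r : M, Continuous (· + r)) {q : M}
    (hq : q + q = q) :
    ∃ e, e + e = e ∧ e = q + e ∧ e = e + q ∧ ∀ r, ∃ s, s + (r + e) = e := by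
  obtain ⟨e, ⟨r₀, rfl⟩, hee, hmin⟩ := exists_idempotent_leftMinimal_mem_range hc q
  dsimp only at hee hmin
  have heq : r₀ + q + q = r₀ + q := by rw [add_assoc, hq]
  generalize r₀ + q = e at hee hmin heq
  -- So far only `e + q = e` is known; adding `q` on the left gives the other half of `≤ q`.
  refine ⟨q + e, ?_, ?_, ?_, fun r => ?_⟩
  · rw [add_assoc, ← add_assoc e, heq, hee]
  · rw [← add_assoc, hq]
  · rw [add_assoc, heq]
  · obtain ⟨s, hs⟩ := hmin (r + q)
    refine ⟨q + s, ?_⟩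
    rw [add_assoc, ← add_assoc r, hs]

end RightTopologicalSemigroup

/-! ### Ultrafilter characterizations of the notions of largeness. -/

section UltrafilterSemigroup

attribute [local instance] Ultrafilter.add Ultrafilter.addSemigroup

variable {S T : Type*} [AddCommMonoid S] [AddCommMonoid T]

theorem Ultrafilter.mem_add_iff {p q : Ultrafilter S} {B : Set S} :
    B ∈ p + q ↔ {x | {y | x + y ∈ B} ∈ q} ∈ p :=
  Iff.rfl

theorem Ultrafilter.map_add_hom (f : T →+ S) (p q : Ultrafilter T) :
    (p + q).map f = p.map f + q.map f := by
  ext B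
  simp only [Ultrafilter.mem_map, Ultrafilter.mem_add_iff, Set.preimage, Set.mem_ofPred_eq, map_add]

theorem isMinimalIdempotent_of_leftMinimal {e : Ultrafilter S} (he : e + e = e)
    (hmin : ∀ r, ∃ s, s + (r + e) = e) : IsMinimalIdempotent e := by
  refine ⟨he, fun q hq h₁ h₂ => ?_⟩
  obtain ⟨s, hs⟩ := hmin q
  rw [← h₂] at hs
  rw [h₁, ← hs, add_assoc, hq]

theorem IsMinimalIdempotent.leftMinimal {e : Ultrafilter S} (he : IsMinimalIdempotent e)
    (r : Ultrafilter S) : ∃ s, s + (r + e) = e := by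
  obtain ⟨e', h₁, h₂, h₃, hmin⟩ :=
    exists_idempotent_leftMinimal_le Ultrafilter.continuous_add_left he.1
  obtain rfl := he.2 e' h₁ h₂ h₃
  exact hmin r

/-- A central set is piecewise syndetic. -/
theorem IsCentral.isPiecewiseSyndetic {C : Set S} (hC : IsCentral C) :
    IsPiecewiseSyndetic C := by
  obtain ⟨e, he, hCe⟩ := hC
  have hcpt : IsCompact (Set.range (· + e)) :=
    isCompact_range (Ultrafilter.continuous_add_left e)
  -- Each `r + e` generates `e`, so it contains some `-t + C`; compactness of `βS + e` makes
  -- finitely many `t` suffice.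
  obtain ⟨G, hG⟩ := hcpt.elim_finite_subcover
    (fun t : S => {q : Ultrafilter S | {y | t + y ∈ C} ∈ q})
    (fun t => ultrafilter_isOpen_basic _) (by
      rintro _ ⟨r, rfl⟩
      obtain ⟨s, hs⟩ := he.leftMinimal r
      rw [← hs, Ultrafilter.mem_add_iff] at hCe
      obtain ⟨t, ht⟩ := Ultrafilter.nonempty_of_mem hCe
      exact Set.mem_iUnion.2 ⟨t, ht⟩)
  have hGmem : ∀ r : Ultrafilter S, ∃ t ∈ G, {y | t + y ∈ C} ∈ r + e := fun r => by
    simpa using hG ⟨r, rfl⟩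
  refine ⟨G, (hGmem e).imp fun t ht => ht.1, fun F _ => ?_⟩
  have hF : (⋂ y ∈ F, {x | ∃ t ∈ G, t + (y + x) ∈ C}) ∈ e := by
    refine (Filter.biInter_finset_mem F).2 fun y _ => ?_
    obtain ⟨t, htG, ht⟩ := hGmem (pure y)
    rw [Ultrafilter.mem_add_iff, Ultrafilter.mem_pure] at ht
    exact Filter.mem_of_superset ht fun x hx => ⟨t, htG, hx⟩
  obtain ⟨x, hx⟩ := Ultrafilter.nonempty_of_mem hF
  exact ⟨x, by simpa using hx⟩

/-- Some translate of a piecewise syndetic set is central. -/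
theorem IsPiecewiseSyndetic.exists_isCentral {C : Set S} (hC : IsPiecewiseSyndetic C) :
    ∃ t : S, IsCentral {y | t + y ∈ C} := by
  obtain ⟨G, hGne, hG⟩ := hC
  let T : Set S := ⋃ t ∈ G, {y | t + y ∈ C}
  -- All `-y + T` have the finite intersection property; a `q` containing them has `T ∈ r + q` for
  -- every `r`.
  obtain ⟨q, hq⟩ := Ultrafilter.exists_ultrafilter_of_finite_inter_nonempty
    (Set.range fun y : S => {x | y + x ∈ T}) (by
      intro 𝒯 h𝒯
      classical
      obtain ⟨F, rfl⟩ : ∃ F : Finset S, F.image (fun y : S => {x | y + x ∈ T}) = 𝒯 := by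
        obtain ⟨F, -, hF⟩ := Finset.subset_set_image_iff.1
          (by simpa [Set.image_univ] using h𝒯 :
            (𝒯 : Set (Set S)) ⊆ (fun y : S => {x | y + x ∈ T}) '' Set.univ)
        exact ⟨F, hF⟩
      rcases F.eq_empty_or_nonempty with rfl | hF
      · exact ⟨0, by simp⟩
      · obtain ⟨x, hx⟩ := hG F hF
        refine ⟨x, ?_⟩
        simpa [T] using hx)
  obtain ⟨e, ⟨r, rfl⟩, he, hmin⟩ :=
    exists_idempotent_leftMinimal_mem_range Ultrafilter.continuous_add_left q
  have hT : T ∈ r + q := by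
    rw [Ultrafilter.mem_add_iff]
    exact Filter.univ_mem' fun y => hq ⟨y, rfl⟩
  obtain ⟨t, -, ht⟩ := (Ultrafilter.finite_biUnion_mem_iff G.finite_toSet).1 hT
  exact ⟨t, _, isMinimalIdempotent_of_leftMinimal he hmin, ht⟩

theorem IsPiecewiseSyndetic.of_translate {C : Set S} (t : S)
    (h : IsPiecewiseSyndetic {y | t + y ∈ C}) : IsPiecewiseSyndetic C := by
  classical
  obtain ⟨G, hGne, hG⟩ := h
  refine ⟨G.image (t + ·), hGne.image _, fun F hF => ?_⟩
  obtain ⟨x, hx⟩ := hG F hF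
  refine ⟨x, fun y hy => ?_⟩
  obtain ⟨s, hs, hsC⟩ := hx y hy
  exact ⟨t + s, Finset.mem_image_of_mem _ hs, by rw [add_assoc]; exact hsC⟩

/-- An idempotent ultrafilter contains the kernel of every homomorphism to a finite group. -/
theorem Ultrafilter.preimage_zero_mem_of_idempotent {K : Type*} [AddCommGroup K] [Finite K]
    (g : S →+ K) {q : Ultrafilter S} (hq : q + q = q) : g ⁻¹' {0} ∈ q := by
  obtain ⟨a, ha⟩ := Ultrafilter.eq_pure_of_finite (q.map g)
  have h : q.map g + q.map g = q.map g := by rw [← Ultrafilter.map_add_hom, hq]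
  have ha0 : a = 0 := by
    have h' : ({a} : Set K) ∈ q.map g + q.map g := by
      rw [h, ha]
      exact Set.mem_singleton a
    rw [ha, Ultrafilter.mem_add_iff] at h'
    have h'' : a + a = a := h'
    simpa using h''
  have : ({0} : Set K) ∈ q.map g := by
    rw [ha, ha0]
    exact Set.mem_singleton _
  exact this

/-- A homomorphism whose range belongs to all idempotents of `βS` maps minimal idempotents to
minimal idempotents. -/
theorem IsMinimalIdempotent.map {p : Ultrafilter T} (hp : IsMinimalIdempotent p) (f : T →+ S)
    (hf : ∀ q : Ultrafilter S, q + q = q → Set.range f ∈ q) :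
    IsMinimalIdempotent (p.map f) := by
  refine ⟨by rw [← Ultrafilter.map_add_hom, hp.1], fun q hq h₁ h₂ => ?_⟩
  obtain ⟨r, hr⟩ : ∃ r : Ultrafilter T, r.map f = q := by
    have : (Filter.comap f (q : Filter S)).NeBot :=
      Filter.comap_neBot_iff.2 fun s hs => by
        obtain ⟨_, hx, a, rfl⟩ := Ultrafilter.nonempty_of_mem (Filter.inter_mem hs (hf q hq))
        exact ⟨a, hx⟩
    refine ⟨Ultrafilter.of (Filter.comap f q), Ultrafilter.coe_le_coe.1 ?_⟩
    exact (Filter.map_mono (Ultrafilter.of_le _)).trans Filter.map_comap_le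
  -- The fibre over `q` inside the left ideal `βT + p`: a compact subsemigroup, so it contains an
  -- idempotent lift of `q`.
  let L : Set (Ultrafilter T) := {r | r.map f = q} ∩ Set.range (· + p)
  have hcont : Continuous (fun r : Ultrafilter T => r.map f) :=
    ultrafilterBasis_is_basis.continuous_iff.2 <| Set.forall_mem_range.mpr fun s =>
      ultrafilter_isOpen_basic (f ⁻¹' s)
  have hL : IsClosed L := (isClosed_singleton.preimage hcont).inter
    (isCompact_range (Ultrafilter.continuous_add_left p)).isClosed
  obtain ⟨e, ⟨heq, s, rfl⟩, hee⟩ := exists_idempotent_in_compact_add_subsemigroup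
    Ultrafilter.continuous_add_left L
    ⟨r + p, by rw [Set.mem_ofPred_eq, Ultrafilter.map_add_hom, hr, ← h₂], r, rfl⟩ hL.isCompact (by
      rintro x ⟨hx, -⟩ y ⟨hy, t, rfl⟩
      refine ⟨?_, x + t, add_assoc _ _ _⟩
      rw [Set.mem_ofPred_eq] at hx hy ⊢
      rw [Ultrafilter.map_add_hom, hx, hy, hq])
  dsimp only at hee
  rw [Set.mem_ofPred_eq] at heq
  have hep : s + p + p = s + p := by rw [add_assoc, hp.1]
  dsimp only at heq
  generalize s + p = e at hee heq hep
  -- `p + e` is an idempotent below `p`, so minimality applies.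
  have hpe : p + e = p := by
    refine hp.2 _ ?_ ?_ ?_
    · rw [add_assoc, ← add_assoc e, hep, hee]
    · rw [← add_assoc, hp.1]
    · rw [add_assoc, hep]
  rw [← hpe, Ultrafilter.map_add_hom, heq, ← h₁]

theorem IsCentralStar.mem {C : Set S} (hC : IsCentralStar C) {p : Ultrafilter S}
    (hp : IsMinimalIdempotent p) : C ∈ p := by
  by_contra h
  obtain ⟨x, hx, hx'⟩ := hC Cᶜ ⟨p, hp, Ultrafilter.compl_mem_iff_notMem.2 h⟩
  exact hx' hx

theorem Hindman.exists_sum_of_mem_FS {a : Stream' S} {m : S} (hm : m ∈ Hindman.FS a) :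
    ∃ F : Finset ℕ, F.Nonempty ∧ ∑ n ∈ F, a.get n = m := by
  induction hm with
  | head' a => exact ⟨{0}, by simp, by simp [Stream'.head]⟩
  | tail' a m _ ih =>
    obtain ⟨F, hF, rfl⟩ := ih
    exact ⟨F.map (addRightEmbedding 1), by simpa using hF, by simp [Stream'.get_tail]⟩
  | cons' a m _ ih =>
    obtain ⟨F, hF, rfl⟩ := ih
    refine ⟨insert 0 (F.map (addRightEmbedding 1)), by simp, ?_⟩
    rw [Finset.sum_insert (by simp)]
    simp [Stream'.get_tail, Stream'.head]

/-- IP sets are the members of idempotent ultrafilters. -/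
theorem isIP_iff_exists_idempotent {B : Set S} :
    IsIP B ↔ ∃ p : Ultrafilter S, p + p = p ∧ B ∈ p := by
  constructor
  · rintro ⟨x, hx⟩
    obtain ⟨p, hp, hmem⟩ := Hindman.exists_idempotent_ultrafilter_le_FS (x : Stream' S)
    refine ⟨p, hp, Filter.mem_of_superset hmem fun m hm => ?_⟩
    obtain ⟨F, hF, rfl⟩ := Hindman.exists_sum_of_mem_FS hm
    exact hx F hF
  · rintro ⟨p, hp, hB⟩
    obtain ⟨a, ha⟩ := Hindman.exists_FS_of_large p hp B hB
    exact ⟨a.get, fun F hF => ha (Hindman.FS.finsetSum a F hF)⟩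

theorem IsIPStar.mem {C : Set S} (hC : IsIPStar C) {p : Ultrafilter S} (hp : p + p = p) :
    C ∈ p := by
  by_contra h
  obtain ⟨x, hx, hx'⟩ :=
    hC Cᶜ (isIP_iff_exists_idempotent.2 ⟨p, hp, Ultrafilter.compl_mem_iff_notMem.2 h⟩)
  exact hx' hx

/-! ### Pulling largeness back along finitely many homomorphisms. -/

variable {ι : Type*} [Finite ι]

theorem IsIPStar.preimages {C : Set S} (hC : IsIPStar C) (f : ι → T →+ S) :
    IsIPStar {y | ∀ i, f i y ∈ C} := by
  intro D hD
  obtain ⟨p, hp, hDp⟩ := isIP_iff_exists_idempotent.1 hD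
  have h : ∀ i, f i ⁻¹' C ∈ p := fun i =>
    hC.mem (p := p.map (f i)) (by rw [← Ultrafilter.map_add_hom, hp])
  have h' : {y | ∀ i, f i y ∈ C} ∈ p := Filter.eventually_all.2 h
  exact Ultrafilter.nonempty_of_mem (Filter.inter_mem h' hDp)

theorem IsCentralStar.preimages {C : Set S} (hC : IsCentralStar C) (f : ι → T →+ S)
    (hf : ∀ i, ∀ q : Ultrafilter S, q + q = q → Set.range (f i) ∈ q) :
    IsCentralStar {y | ∀ i, f i y ∈ C} := by
  rintro D ⟨p, hp, hDp⟩
  have h : ∀ i, f i ⁻¹' C ∈ p := fun i => hC.mem (hp.map (f i) (hf i))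
  have h' : {y | ∀ i, f i y ∈ C} ∈ p := Filter.eventually_all.2 h
  exact Ultrafilter.nonempty_of_mem (Filter.inter_mem h' hDp)

theorem IsPSStar.preimages {C : Set S} (hC : IsPSStar C) (f : ι → T →+ S)
    (hf : ∀ i, ∀ q : Ultrafilter S, q + q = q → Set.range (f i) ∈ q) :
    IsPSStar {y | ∀ i, f i y ∈ C} := by
  intro D hD
  obtain ⟨t, e, he, hDe⟩ := hD.exists_isCentral
  -- Otherwise a translate of `Cᶜ` is central, so `Cᶜ` is piecewise syndetic, contradicting PS*.
  have h : ∀ i, {y | f i (t + y) ∈ C} ∈ e := by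
    intro i
    by_contra h
    have hcentral : IsCentral {y | f i t + y ∈ Cᶜ} := by
      refine ⟨e.map (f i), he.map (f i) (hf i), ?_⟩
      have := Ultrafilter.compl_mem_iff_notMem.2 h
      simp only [map_add] at this
      exact this
    obtain ⟨x, hx, hx'⟩ := hC _ (hcentral.isPiecewiseSyndetic.of_translate (f i t))
    exact hx' hx
  have h' : {y | ∀ i, f i (t + y) ∈ C} ∈ e := Filter.eventually_all.2 h
  obtain ⟨y, hy, hy'⟩ := Ultrafilter.nonempty_of_mem (Filter.inter_mem h' hDe)
  exact ⟨t + y, hy, hy'⟩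

/-- A minimal idempotent `e` below `δ(p)` is sent by every `f i` to an idempotent below `p`, hence
to `p` itself; so one `e` serves all coordinates. -/
theorem IsCentral.preimages {C : Set S} (hC : IsCentral C) (f : ι → T →+ S) (δ : S →+ T)
    (hδ : ∀ i s, f i (δ s) = s) : IsCentral {y | ∀ i, f i y ∈ C} := by
  obtain ⟨p, hp, hCp⟩ := hC
  obtain ⟨e, hee, h₁, h₂, hmin⟩ := exists_idempotent_leftMinimal_le
    Ultrafilter.continuous_add_left (q := p.map δ) (by rw [← Ultrafilter.map_add_hom, hp.1])
  refine ⟨e, isMinimalIdempotent_of_leftMinimal hee hmin, ?_⟩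
  have hmap : ∀ i, (p.map δ).map (f i) = p := fun i => by
    rw [Ultrafilter.map_map, show f i ∘ δ = id from funext (hδ i), Ultrafilter.map_id]
  have h : ∀ i, f i ⁻¹' C ∈ e := fun i => by
    have : e.map (f i) = p := by
      refine hp.2 _ ?_ ?_ ?_
      · rw [← Ultrafilter.map_add_hom, hee]
      · conv_lhs => rw [h₁, Ultrafilter.map_add_hom, hmap]
      · conv_lhs => rw [h₂, Ultrafilter.map_add_hom, hmap]
    rw [← this] at hCp
    exact hCp
  exact Filter.eventually_all.2 h

theorem IsPiecewiseSyndetic.preimages {C : Set S} (hC : IsPiecewiseSyndetic C) (f : ι → T →+ S)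
    (δ : S →+ T) (hδ : ∀ i s, f i (δ s) = s) : IsPiecewiseSyndetic {y | ∀ i, f i y ∈ C} := by
  obtain ⟨t, ht⟩ := hC.exists_isCentral
  refine IsPiecewiseSyndetic.of_translate (δ t) ?_
  simpa [hδ] using (ht.preimages f δ hδ).isPiecewiseSyndetic

/-- Thick sets are those containing a translate of every finite set. -/
theorem isThick_iff {B : Set S} :
    IsThick B ↔ ∀ F : Finset S, ∃ x, ∀ y ∈ F, y + x ∈ B := by
  constructor
  · intro hB F
    by_contra! h
    have hF : F.Nonempty := (h 0).imp fun y hy => hy.1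
    obtain ⟨x, hx, hx'⟩ := hB Bᶜ ⟨F, hF, h⟩
    exact hx' hx
  · rintro h D ⟨G, -, hG⟩
    obtain ⟨x, hx⟩ := h G
    obtain ⟨t, ht, htD⟩ := hG x
    exact ⟨t + x, hx t ht, htD⟩

theorem IsThick.preimages {C : Set S} (hC : IsThick C) (f : ι → T →+ S)
    (δ : S →+ T) (hδ : ∀ i s, f i (δ s) = s) : IsThick {y | ∀ i, f i y ∈ C} := by
  classical
  have := Fintype.ofFinite ι
  rw [isThick_iff] at hC ⊢
  intro F
  obtain ⟨x, hx⟩ := hC (Finset.univ.biUnion fun i => F.image (f i))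
  refine ⟨δ x, fun y hy i => ?_⟩
  rw [map_add, hδ]
  exact hx _ (Finset.mem_biUnion.2 ⟨i, Finset.mem_univ i, Finset.mem_image_of_mem _ hy⟩)

end UltrafilterSemigroup

/-! ### Δ* sets via iterated ultrafilter limits. -/

section Delta

variable {S T : Type*} [AddCommGroup S] [AddCommGroup T]

/-- If almost all pairs of indices give a relation, there is an increasing sequence of indices all
of whose pairs satisfy it. -/
theorem Ultrafilter.exists_seq_pairwise {α : Type*} (U : Ultrafilter α) (R : α → α → Prop)
    (h : ∀ᶠ n in U, ∀ᶠ m in U, R n m) : ∃ k : ℕ → α, ∀ i j, i < j → R (k i) (k j) := by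
  obtain ⟨k, hk⟩ := exists_seq_of_forall_finset_exists
    (fun n => ∀ᶠ m in (U : Filter α), R n m) R (fun s hs => by
      have h' : ∀ᶠ m in (U : Filter α), ∀ n ∈ s, R n m :=
        (Filter.eventually_all_finset s).2 hs
      obtain ⟨m, hm⟩ := (h.and h').exists
      exact ⟨m, hm⟩)
  exact ⟨k, fun i j hij => hk.2 i j hij⟩

/-- If this failed, a subsequence would have all its differences in `Cᶜ`, making `Cᶜ` a Δ set. -/
theorem IsDeltaStar.eventually_sub_mem {C : Set S} (hC : IsDeltaStar C) {α : Type*}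
    (U : Ultrafilter α) (x : α → S) : ∀ᶠ n in U, ∀ᶠ m in U, x m - x n ∈ C := by
  by_contra h
  simp only [← Ultrafilter.eventually_not] at h
  obtain ⟨k, hk⟩ := U.exists_seq_pairwise _ h
  obtain ⟨s, hs, hs'⟩ := hC Cᶜ ⟨fun i => x (k i), fun n m hnm => ⟨_, hk n m hnm, by abel⟩⟩
  exact hs' hs

theorem IsDeltaStar.preimages {ι : Type*} [Finite ι] {C : Set S} (hC : IsDeltaStar C)
    (f : ι → T →+ S) : IsDeltaStar {y | ∀ i, f i y ∈ C} := by
  rintro D ⟨x, hx⟩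
  -- Nonprincipality lets `m` be chosen beyond `n`.
  let U := Filter.hyperfilter ℕ
  have h : ∀ᶠ n in (U : Filter ℕ), ∀ᶠ m in (U : Filter ℕ), ∀ i, f i (x m - x n) ∈ C := by
    simp only [Filter.eventually_all, map_sub]
    exact fun i => hC.eventually_sub_mem U fun n => f i (x n)
  obtain ⟨n, hn⟩ := h.exists
  have hlt : ∀ᶠ m in (U : Filter ℕ), n < m :=
    (Nat.cofinite_eq_atTop ▸ Filter.hyperfilter_le_cofinite :
      (U : Filter ℕ) ≤ Filter.atTop) (Filter.eventually_gt_atTop n)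
  obtain ⟨m, hm, hnm⟩ := (hn.and hlt).exists
  obtain ⟨b, hb, hmb⟩ := hx n m hnm
  refine ⟨b, fun i => ?_, hb⟩
  have := hm i
  rwa [hmb, add_sub_cancel_left] at this

end Delta

/-! ### Arithmetic of the image group. -/

section GaussianMatrix

attribute [local instance] Ultrafilter.add

/-- Idempotent ultrafilters on `ℤ[i]` contain the multiples of every nonzero integer. -/
theorem GaussianInt.setOf_dvd_mem_of_idempotent {n : ℕ} (hn : n ≠ 0)
    {q : Ultrafilter GaussianInt} (hq : q + q = q) : {x | (n : GaussianInt) ∣ x} ∈ q := by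
  have : NeZero n := ⟨hn⟩
  let g : GaussianInt →+ ZMod n × ZMod n :=
    { toFun := fun x => (x.re, x.im)
      map_zero' := by simp
      map_add' := by simp }
  refine Filter.mem_of_superset (Ultrafilter.preimage_zero_mem_of_idempotent g hq) fun x hx => ?_
  have hx' : (x.re : ZMod n) = 0 ∧ (x.im : ZMod n) = 0 := by
    simpa [g] using hx
  rw [ZMod.intCast_zmod_eq_zero_iff_dvd, ZMod.intCast_zmod_eq_zero_iff_dvd] at hx'
  have := (Zsqrtd.intCast_dvd (d := -1) (n : ℤ) x).2 hx'
  simpa using this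

theorem exists_natCast_mul_eq_toComplex {a : ℂ}
    (ha : a ∈ Algebra.adjoin ℚ ({Complex.I} : Set ℂ)) :
    ∃ n : ℕ, n ≠ 0 ∧ ∃ g : GaussianInt, (n : ℂ) * a = GaussianInt.toComplex g := by
  induction ha using Algebra.adjoin_induction with
  | mem x hx =>
    obtain rfl := hx
    exact ⟨1, one_ne_zero, ⟨0, 1⟩, by simp [GaussianInt.toComplex_def]⟩
  | algebraMap r =>
    refine ⟨r.den, r.den_nz, (r.num : GaussianInt), ?_⟩
    have : (r.den : ℚ) * r = r.num := Rat.den_mul_eq_num r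
    rw [eq_ratCast, map_intCast]
    exact_mod_cast congrArg (Rat.cast : ℚ → ℂ) this
  | add x y _ _ hx hy =>
    obtain ⟨n, hn, g, hg⟩ := hx
    obtain ⟨m, hm, k, hk⟩ := hy
    refine ⟨n * m, mul_ne_zero hn hm, m * g + n * k, ?_⟩
    simp only [map_add, map_mul, map_natCast, ← hg, ← hk, Nat.cast_mul]
    ring
  | mul x y _ _ hx hy =>
    obtain ⟨n, hn, g, hg⟩ := hx
    obtain ⟨m, hm, k, hk⟩ := hy
    refine ⟨n * m, mul_ne_zero hn hm, g * k, ?_⟩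
    simp only [map_mul, ← hg, ← hk, Nat.cast_mul]
    ring

variable {u v : ℕ} {A : Matrix (Fin u) (Fin v) ℂ}

theorem smul_mem_imageGroup (w : GaussianInt) {y : Fin u → GaussianInt}
    (hy : y ∈ imageGroup A) : w • y ∈ imageGroup A := by
  obtain ⟨z, hz⟩ := hy
  refine ⟨w • z, ?_⟩
  have : (fun j => GaussianInt.toComplex ((w • z) j)) =
      GaussianInt.toComplex w • fun j => GaussianInt.toComplex (z j) := by
    ext j
    simp
  rw [this, Matrix.mulVec_smul, hz]
  ext i
  simp

/-- If the `i`-th row of `A` is nonzero, some vector of the image group has a nonzero `i`-th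
coordinate. -/
theorem exists_mem_imageGroup_apply_ne_zero
    (hA : ∀ i j, A i j ∈ Algebra.adjoin ℚ ({Complex.I} : Set ℂ)) {i : Fin u}
    (hi : ∃ j, A i j ≠ 0) : ∃ y ∈ imageGroup A, y i ≠ 0 := by
  obtain ⟨j, hj⟩ := hi
  choose n hn g hg using fun k => exists_natCast_mul_eq_toComplex (hA k j)
  have hprod : ∀ k, ∃ c : ℕ, ∏ l, n l = c * n k := fun k =>
    ⟨_, (Finset.prod_erase_mul _ _ (Finset.mem_univ k)).symm⟩
  choose c hc using hprod
  have hval : ∀ k, A k j * ((∏ l, n l : ℕ) : ℂ) = GaussianInt.toComplex (c k * g k) := fun k => by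
    rw [map_mul, ← hg, map_natCast, hc k, Nat.cast_mul]
    ring
  -- The image of the `j`-th basis vector, scaled to clear the denominators of column `j`.
  refine ⟨fun k => c k * g k, ⟨Pi.single j ((∏ l, n l : ℕ) : GaussianInt), ?_⟩, fun h => ?_⟩
  · ext k
    rw [← hval, Matrix.mulVec, dotProduct, Finset.sum_eq_single j]
    · simp
    · intro l _ hl
      simp [hl]
    · simp
  · have := hval i
    rw [show (c i : GaussianInt) * g i = 0 from h, map_zero, mul_eq_zero, Nat.cast_eq_zero,
      Finset.prod_eq_zero_iff] at this
    rcases this with h0 | ⟨l, -, hl⟩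
    · exact hj h0
    · exact hn l hl

/-- The `i`-th coordinate on the image group. -/
noncomputable def imageGroupCoord (A : Matrix (Fin u) (Fin v) ℂ) (i : Fin u) :
    imageGroup A →+ GaussianInt :=
  (Pi.evalAddMonoidHom (fun _ => GaussianInt) i).comp (imageGroup A).subtype

/-- The diagonal embedding of `ℤ[i]` into an image group containing `(1, …, 1)`. -/
noncomputable def imageGroupDiagonal (h : (fun _ => 1) ∈ imageGroup A) :
    GaussianInt →+ imageGroup A where
  toFun w := ⟨w • fun _ => 1, smul_mem_imageGroup w h⟩
  map_zero' := by
    ext1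
    simp
  map_add' _ _ := by
    ext1
    simp [add_smul]

theorem range_imageGroupCoord_mem_of_idempotent
    (hA : ∀ i j, A i j ∈ Algebra.adjoin ℚ ({Complex.I} : Set ℂ)) {i : Fin u}
    (hi : ∃ j, A i j ≠ 0) {q : Ultrafilter GaussianInt} (hq : q + q = q) :
    Set.range (imageGroupCoord A i) ∈ q := by
  obtain ⟨y, hy, hyi⟩ := exists_mem_imageGroup_apply_ne_zero hA hi
  have hnorm : ((y i).norm.natAbs : GaussianInt) = y i * star (y i) := by
    rw [← Zsqrtd.norm_eq_mul_conj, ← Int.cast_natCast,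
      Int.natAbs_of_nonneg (GaussianInt.norm_nonneg _)]
  have hne : (y i).norm.natAbs ≠ 0 := by
    simpa [GaussianInt.norm_eq_zero] using hyi
  refine Filter.mem_of_superset (GaussianInt.setOf_dvd_mem_of_idempotent hne hq) ?_
  rintro x ⟨w, rfl⟩
  -- Scaling `y` by `star (y i) * w` makes its `i`-th coordinate `norm (y i) * w`.
  refine ⟨⟨_, smul_mem_imageGroup (star (y i) * w) hy⟩, ?_⟩
  rw [hnorm]
  simp only [imageGroupCoord, AddMonoidHom.comp_apply, AddSubgroup.subtype_apply,
    Pi.evalAddMonoidHom_apply, Pi.smul_apply, smul_eq_mul]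
  ring

end GaussianMatrix

theorem theorem1p5 {u v : ℕ} (A : Matrix (Fin u) (Fin v) ℂ)
    (hA : ∀ i j, A i j ∈ Algebra.adjoin ℚ ({Complex.I} : Set ℂ))
    (C : Set GaussianInt) :
    ((IsIPStar C → IsIPStar (imagesIn A C)) ∧
      (IsDeltaStar C → IsDeltaStar (imagesIn A C)) ∧
      ((∀ i, ∃ j, A i j ≠ 0) →
        (IsPSStar C → IsPSStar (imagesIn A C)) ∧
        (IsCentralStar C → IsCentralStar (imagesIn A C)))) ∧
    ((fun _ => 1) ∈ imageGroup A →
      (IsPiecewiseSyndetic C → IsPiecewiseSyndetic (imagesIn A C)) ∧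
      (IsCentral C → IsCentral (imagesIn A C)) ∧
      (IsThick C → IsThick (imagesIn A C))) := by
  refine ⟨⟨fun hC => hC.preimages (imageGroupCoord A),
    fun hC => hC.preimages (imageGroupCoord A), fun hrow => ?_⟩, fun h1 => ?_⟩
  · have hf := fun i (q : Ultrafilter GaussianInt) =>
      range_imageGroupCoord_mem_of_idempotent hA (hrow i) (q := q)
    exact ⟨fun hC => hC.preimages (imageGroupCoord A) hf,
      fun hC => hC.preimages (imageGroupCoord A) hf⟩
  · have hδ : ∀ i s, imageGroupCoord A i (imageGroupDiagonal h1 s) = s := fun i s => by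
      simp [imageGroupCoord, imageGroupDiagonal]
    exact ⟨fun hC => hC.preimages _ _ hδ, fun hC => hC.preimages _ _ hδ,
      fun hC => hC.preimages _ _ hδ⟩
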